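/- For Polish spaces $P,Q$ and equivalence relations $E$ on $P$ and $F$ on $Q$, write $E\le_B F$ if there is a Borel map $\theta:P\to Q$ such that $(x,y)\in E\iff(\theta(x),\theta(y))\in F$ for all $x,y\in P$; write $E\sim_B F$ if $E\le_B F$ and $F\le_B E$; and call $E,F$ Borel comparable if $E\le_B F$ or $F\le_B E$. For a separable Banach space $X$, let $E(X,0)=X^{\mathbb N}/c_0(X)$ be the equivalence relation on $X^{\mathbb N}$ (with the product topology) given by $$(x,y)\in E(X,0)\iff \lim_{n\to\infty}\|x(n)-y(n)\|=0,$$ and for $p\in[1,+\infty)$ let $E(X,p)=X^{\mathbb N}/\ell_p(X)$ be given by $$(x,y)\in E(X,p)\iff \sum_{n\in\mathbb N}\|x(n)-y(n)\|^p<+\infty.$$ Write $\mathbb R^{\mathbb N}/c_0=E(\mathbb R,0)$. Theorem. Let $X\neq\{0\}$ be a separable Banach space. Then $E(X,0)\sim_B\mathbb R^{\mathbb N}/c_0$, and for every $p\in[1,+\infty)$ the relations $E(X,p)$ and $\mathbb R^{\mathbb N}/c_0$ are not Borel comparable; that is, $E(X,p)\not\le_B\mathbb R^{\mathbb N}/c_0$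 and $\mathbb R^{\mathbb N}/c_0\not\le_B E(X,p)$. -/

import Mathlib

open Filter Topology

/-- `E ≤_B F`: there is a Borel map `θ` (measurable for the Borel σ-algebras of the topologies)
with `x E y ↔ θ x F θ y`. It is used for equivalence relations on Polish spaces. -/
def BorelReducible {α β : Type*} [TopologicalSpace α] [TopologicalSpace β]
    (E : Setoid α) (F : Setoid β) : Prop :=
  ∃ θ : α → β, @Measurable α β (borel α) (borel β) θ ∧ ∀ x y : α, E x y ↔ F (θ x) (θ y)

/-- `E ∼_B F`. -/
def BorelBireducible {α β : Type*} [TopologicalSpace α] [TopologicalSpace β]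
    (E : Setoid α) (F : Setoid β) : Prop :=
  BorelReducible E F ∧ BorelReducible F E

/-- `E` and `F` are Borel comparable: one of them is Borel reducible to the other. -/
def BorelComparable {α β : Type*} [TopologicalSpace α] [TopologicalSpace β]
    (E : Setoid α) (F : Setoid β) : Prop :=
  BorelReducible E F ∨ BorelReducible F E

/-- The relation `E(M, 0)` on `M^ℕ`: `d(x(n), y(n)) → 0`.
For a normed space `X` it is `X^ℕ / c₀(X)`, and for `M = ℝ` it is `ℝ^ℕ / c₀`. -/
def c0Equiv (M : Type*) [PseudoMetricSpace M] : Setoid (ℕ → M) where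
  r x y := Tendsto (fun n => dist (x n) (y n)) atTop (𝓝 0)
  iseqv :=
    { refl := fun x => by simp
      symm := fun {x y} h => by simpa only [dist_comm] using h
      trans := fun {x y z} h₁ h₂ =>
        squeeze_zero (fun _ => dist_nonneg) (fun n => dist_triangle (x n) (y n) (z n))
          (by simpa using h₁.add h₂) }

/-- The relation `E(M, p)` on `M^ℕ` for `p ∈ [1, ∞)`: `∑ d(x(n), y(n))^p < ∞`.
For a normed space `X` it is `X^ℕ / ℓ_p(X)`. -/
def lpEquiv (M : Type*) [PseudoMetricSpace M] (p : ℝ) (hp : 1 ≤ p) : Setoid (ℕ → M) where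
  r x y := Summable fun n => dist (x n) (y n) ^ p
  iseqv :=
    { refl := fun x => by
        simp [Real.zero_rpow (show p ≠ 0 by linarith)]
      symm := fun {x y} h => by simpa only [dist_comm] using h
      trans := fun {x y z} h₁ h₂ => by
        refine Summable.of_nonneg_of_le (fun n => by positivity) (fun n => ?_)
          ((h₁.add h₂).mul_left ((2 : ℝ) ^ (p - 1)))
        exact (Real.rpow_le_rpow dist_nonneg (dist_triangle (x n) (y n) (z n))
          (by linarith)).trans (by
            exact_mod_cast NNReal.rpow_add_le_mul_rpow_add_rpow
              (nndist (x n) (y n)) (nndist (y n) (z n)) hp) }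

/-! The bumps at scales `2^-k` embed a separable space in `c₀` uniformly: they are 1-Lipschitz,
point-finite at each scale, and they separate points at distance `4 * 2^-k`. Applied coordinatewise,
this reduces `E(X, 0)` to `ℝ^ℕ / c₀`; a unit vector gives the converse.

Both negative results are category arguments on Cantor space. A Borel reduction is continuous on a
dense `G_δ` set closed under finite changes, and `exists_fusion` builds limit points inside that
set.

The relation `E(X, p)` is a countable union of closed sets, while `ℝ^ℕ / c₀` contains a copy of
"finite difference in every column". Changing one column after another, one leaves each closed set
in turn and still ends at an equivalent point.

Conversely, `E(X, p)` contains a copy of "difference set of finite weight" for harmonic weights. A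
reduction to `c₀` must locally send pairs at small weight distance to uniformly close tails
(`exists_tailClose`). Flipping many light blocks far out then makes the weight large while the image
barely moves in supremum norm; in the limit the weight is infinite but the images stay
`c₀`-equivalent. -/

/-! ### Baire category and fusion on sequence spaces. -/

/-- A Borel map into a second countable space is continuous on a residual set. -/
lemma exists_mem_residual_continuousOn {α β : Type*} [TopologicalSpace α] [TopologicalSpace β]
    [SecondCountableTopology β] {θ : α → β} (hθ : @Measurable α β (borel α) (borel β) θ) :
    ∃ C ∈ residual α, ContinuousOn θ C := by
  borelize α β
  have key : ∀ V : Set β, ∃ u : Set α, IsOpen V → IsOpen u ∧ (θ ⁻¹' V) =ᵇ u := by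
    intro V
    by_cases hV : IsOpen V
    · obtain ⟨u, hu⟩ := (hθ hV.measurableSet).residualEq_isOpen
      exact ⟨u, fun _ => hu⟩
    · exact ⟨∅, fun h => absurd h hV⟩
  choose u hu using key
  let b := TopologicalSpace.countableBasis β
  have hb := TopologicalSpace.isBasis_countableBasis β
  refine ⟨{x | ∀ V ∈ b, (x ∈ θ ⁻¹' V ↔ x ∈ u V)}, ?_, ?_⟩
  · refine (eventually_countable_ball (TopologicalSpace.countable_countableBasis β)).2 ?_
    intro V hV
    exact (eventuallyEq_set.1 (hu V (hb.isOpen hV)).2)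
  · intro x hx
    rw [ContinuousWithinAt, (hb.nhds_hasBasis).tendsto_right_iff]
    rintro V ⟨hV, hxV⟩
    have hux : u V ∈ 𝓝 x := (hu V (hb.isOpen hV)).1.mem_nhds ((hx V hV).1 hxV)
    filter_upwards [mem_nhdsWithin_of_mem_nhds hux, self_mem_nhdsWithin] with y hy hyC
    exact (hyC V hV).2 hy

/-- Flip the coordinates of a binary sequence that lie in `S`. -/
noncomputable def flipOn (S : Set ℕ) (x : ℕ → Bool) : ℕ → Bool :=
  open Classical in fun n => if n ∈ S then !x n else x n

lemma flipOn_of_mem {S : Set ℕ} {n : ℕ} (h : n ∈ S) (x : ℕ → Bool) :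
    flipOn S x n = !x n := by simp [flipOn, h]

lemma flipOn_of_notMem {S : Set ℕ} {n : ℕ} (h : n ∉ S) (x : ℕ → Bool) :
    flipOn S x n = x n := by simp [flipOn, h]

lemma continuous_flipOn (S : Set ℕ) : Continuous (flipOn S) := by
  refine continuous_pi fun n => ?_
  by_cases h : n ∈ S
  · simp only [flipOn_of_mem h]; fun_prop
  · simp only [flipOn_of_notMem h]; fun_prop

lemma flipOn_flipOn (S : Set ℕ) (x : ℕ → Bool) : flipOn S (flipOn S x) = x := by
  ext n; by_cases h : n ∈ S <;> simp [flipOn, h]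

lemma eventually_residual_flipOn {C : Set (ℕ → Bool)} (hC : C ∈ residual (ℕ → Bool)) (S : Set ℕ) :
    ∀ᶠ x in residual (ℕ → Bool), flipOn S x ∈ C := by
  let e : (ℕ → Bool) ≃ₜ (ℕ → Bool) :=
    { toFun := flipOn S, invFun := flipOn S, left_inv := flipOn_flipOn S,
      right_inv := flipOn_flipOn S, continuous_toFun := continuous_flipOn S,
      continuous_invFun := continuous_flipOn S }
  exact tendsto_residual_of_isOpenMap e.continuous e.isOpenMap hC

lemma Filter.EventuallyEq.finite_ne {x y : ℕ → Bool} (h : x =ᶠ[atTop] y) :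
    {n | x n ≠ y n}.Finite := by
  rw [← Nat.cofinite_eq_atTop] at h
  exact h

/-- A residual set of binary sequences contains a dense `G_δ` set that is closed under changing
finitely many coordinates. -/
lemma exists_isGδ_tail_invariant {R : Set (ℕ → Bool)} (hR : R ∈ residual (ℕ → Bool)) :
    ∃ C ⊆ R, IsGδ C ∧ Dense C ∧ ∀ x ∈ C, ∀ y, y =ᶠ[atTop] x → y ∈ C := by
  obtain ⟨t, htR, ht, htd⟩ := mem_residual.1 hR
  -- Only countably many finite changes exist, so the tail-invariant core is a countable
  -- intersection of homeomorphic preimages of `t`.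
  have hEq : {x : ℕ → Bool | ∀ y, y =ᶠ[atTop] x → y ∈ t} =
      ⋂ F : Finset ℕ, flipOn (F : Set ℕ) ⁻¹' t := by
    ext x
    simp only [Set.mem_ofPred_eq, Set.mem_iInter, Set.mem_preimage]
    constructor
    · intro h F
      refine h _ ?_
      filter_upwards [F.finite_toSet.eventually_cofinite_notMem.filter_mono
        Nat.cofinite_eq_atTop.ge] with n hn
      exact flipOn_of_notMem hn x
    · intro h y hy
      have hfin := hy.finite_ne
      have := h hfin.toFinset
      convert this using 1
      ext n
      by_cases hn : y n = x n
      · simp [flipOn, hn]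
      · simp only [flipOn, Set.Finite.coe_toFinset, Set.mem_ofPred_eq, ne_eq, hn,
          not_false_eq_true, if_true]
        cases h1 : y n <;> cases h2 : x n <;> simp_all
  refine ⟨{x | ∀ y, y =ᶠ[atTop] x → y ∈ t}, fun x hx => htR (hx x EventuallyEq.rfl), ?_, ?_, ?_⟩
  · rw [hEq]
    exact IsGδ.iInter fun F => ht.preimage (continuous_flipOn _)
  · refine dense_of_mem_residual ?_
    rw [hEq]
    exact countable_iInter_mem.2 fun F =>
      eventually_residual_flipOn (residual_of_dense_Gδ ht htd) _
  · intro x hx y hy z hz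
    exact hx z (hz.trans hy)

lemma exists_cylinder_subset {B : Type*} [TopologicalSpace B] [DiscreteTopology B]
    {x : ℕ → B} {N : Set (ℕ → B)} (hN : N ∈ 𝓝 x) : ∃ K, PiNat.cylinder x K ⊆ N := by
  obtain ⟨s, hs, hxs, hsN⟩ :=
    (PiNat.isTopologicalBasis_cylinders (fun _ : ℕ => B)).mem_nhds_iff.1 hN
  obtain ⟨z, K, rfl⟩ := hs
  refine ⟨K, ?_⟩
  rw [PiNat.mem_cylinder_iff_eq] at hxs
  rwa [hxs]

lemma cylinder_mem_nhds {B : Type*} [TopologicalSpace B] [DiscreteTopology B]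
    (x : ℕ → B) (K : ℕ) : PiNat.cylinder x K ∈ 𝓝 x :=
  (PiNat.isOpen_cylinder (fun _ : ℕ => B) x K).mem_nhds (PiNat.self_mem_cylinder x K)

/-- Fusion: if from every state one can pass to a next state whose point agrees with the present
one on any prescribed initial segment, then there is a run of states whose points converge to a
point of the `G_δ` set `C` that lies in all neighbourhoods attached to the states of the run. -/
lemma exists_fusion {B σ : Type*} [TopologicalSpace B] [DiscreteTopology B]
    {C : Set (ℕ → B)} (hC : IsGδ C) (pt : σ → ℕ → B) (hpt : ∀ s, pt s ∈ C)
    (nb : σ → Set (ℕ → B)) (hnb : ∀ s, nb s ∈ 𝓝[C] pt s) (R : σ → σ → Prop)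
    (step : ∀ s K, ∃ s', R s s' ∧ pt s' ∈ PiNat.cylinder (pt s) K) (s₀ : σ) :
    ∃ u : ℕ → σ, u 0 = s₀ ∧ (∀ i, R (u i) (u (i + 1))) ∧
      ∃ y ∈ C, (∀ i, y ∈ nb (u i)) ∧ Tendsto (fun i => pt (u i)) atTop (𝓝 y) := by
  obtain ⟨V, hVo, rfl⟩ := isGδ_iff_eq_iInter_nat.1 hC
  have hfr : ∀ (i : ℕ) (s : σ), ∃ K, i < K ∧ PiNat.cylinder (pt s) K ⊆ V i ∧
      PiNat.cylinder (pt s) K ∩ (⋂ i, V i) ⊆ nb s := by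
    intro i s
    obtain ⟨K₁, h₁⟩ := exists_cylinder_subset ((hVo i).mem_nhds (Set.mem_iInter.1 (hpt s) i))
    obtain ⟨N, hN, hN'⟩ := mem_nhdsWithin_iff_exists_mem_nhds_inter.1 (hnb s)
    obtain ⟨K₂, h₂⟩ := exists_cylinder_subset hN
    -- The bound `i + 1` makes the frozen prefixes exhaust all coordinates.
    refine ⟨max (i + 1) (max K₁ K₂), by omega, ?_, ?_⟩
    · exact (PiNat.cylinder_anti _ (by omega)).trans h₁
    · exact (Set.inter_subset_inter_left _
        ((PiNat.cylinder_anti _ (by omega)).trans h₂)).trans hN'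
  choose fr hfr₁ hfr₂ hfr₃ using hfr
  choose nx hnx₁ hnx₂ using step
  let v : ℕ → σ × ℕ := fun i => Nat.rec (s₀, fr 0 s₀)
    (fun j p => (nx p.1 p.2, max p.2 (fr (j + 1) (nx p.1 p.2)))) i
  have hv : ∀ i, v (i + 1) = (nx (v i).1 (v i).2,
      max (v i).2 (fr (i + 1) (nx (v i).1 (v i).2))) := fun i => rfl
  have hK : ∀ i, fr i (v i).1 ≤ (v i).2 := by
    intro i
    cases i with
    | zero => exact le_rfl
    | succ i => rw [hv]; exact le_max_right _ _
  have hmono : Monotone fun i => (v i).2 := monotone_nat_of_le_succ fun i => by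
    rw [hv]; exact le_max_left _ _
  have hstep : ∀ i, ∀ n < (v i).2, pt (v (i + 1)).1 n = pt (v i).1 n := fun i => by
    rw [hv]; exact hnx₂ _ _
  have hall : ∀ i j, i ≤ j → ∀ n < (v i).2, pt (v j).1 n = pt (v i).1 n := by
    intro i j hij
    induction j, hij using Nat.le_induction with
    | base => intros; rfl
    | succ j hij ih =>
      intro n hn
      rw [hstep j n (hn.trans_le (hmono hij)), ih n hn]
  have hlt : ∀ n, n < (v n).2 := fun n => (hfr₁ n _).trans_le (hK n)
  let y : ℕ → B := fun n => pt (v n).1 n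
  have hy : ∀ i, ∀ n < (v i).2, y n = pt (v i).1 n := by
    intro i n hn
    rcases le_total i n with h | h
    · exact hall i n h n hn
    · exact (hall n i h n (hlt n)).symm
  have hyc : ∀ i, y ∈ PiNat.cylinder (pt (v i).1) (fr i (v i).1) := fun i n hn =>
    hy i n (hn.trans_le (hK i))
  have hyC : y ∈ ⋂ i, V i := Set.mem_iInter.2 fun i => hfr₂ i _ (hyc i)
  refine ⟨fun i => (v i).1, rfl, fun i => ?_, y, hyC, fun i => hfr₃ i _ ⟨hyc i, hyC⟩, ?_⟩
  · exact hnx₁ _ _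
  · refine tendsto_pi_nhds.2 fun n => tendsto_const_nhds.congr' ?_
    filter_upwards [eventually_ge_atTop n] with i hi
    exact hy i n ((hlt n).trans_le (hmono hi))

/-! ### Finite columns against countable unions of closed sets. -/

/-- The relation of differing only finitely often in each column on binary sequences, whose
coordinates are split into infinitely many infinite columns, is not Borel reducible to a countable
union of closed relations. -/
theorem not_forall_finite_columns_iff {β : Type*} [TopologicalSpace β]
    [SecondCountableTopology β] {col : ℕ → ℕ} (hcol : ∀ k, {n | col n = k}.Infinite)
    {θ : (ℕ → Bool) → β} (hθ : @Measurable _ _ (borel _) (borel _) θ)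
    {F : ℕ → Set (β × β)} (hF : ∀ M, IsClosed (F M)) :
    ¬ ∀ x y, (∀ k, {n | col n = k ∧ x n ≠ y n}.Finite) ↔ ∃ M, (θ x, θ y) ∈ F M := by
  intro hred
  obtain ⟨R, hR, hcont⟩ := exists_mem_residual_continuousOn hθ
  obtain ⟨C, hCR, hCG, hCd, hCinv⟩ := exists_isGδ_tail_invariant hR
  replace hcont := hcont.mono hCR
  have hCres := residual_of_dense_Gδ hCG hCd
  -- Generic `x` whose full column flips also lie in `C`, so that `θ` is still controlled at points
  -- differing from `x` on a whole column.
  obtain ⟨x, hxC, hxcol⟩ : ∃ x ∈ C, ∀ k, flipOn {n | col n = k} x ∈ C := by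
    have h : ∀ᶠ x in residual (ℕ → Bool), x ∈ C ∧ ∀ k, flipOn {n | col n = k} x ∈ C :=
      Eventually.and hCres (eventually_countable_forall.2 fun k =>
        eventually_residual_flipOn hCres _)
    exact (dense_of_mem_residual h).nonempty
  have hopen : ∀ y ∈ C, ∀ M, (θ x, θ y) ∉ F M → ∀ᶠ z in 𝓝[C] y, (θ x, θ z) ∉ F M := by
    intro y hy M hM
    have h : Tendsto (fun z => (θ x, θ z)) (𝓝[C] y) (𝓝 (θ x, θ y)) :=
      tendsto_const_nhds.prodMk_nhds (hcont y hy)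
    exact h.eventually ((hF M).isOpen_compl.mem_nhds hM)
  have claim : ∀ (z : ℕ → Bool) (K M : ℕ), z =ᶠ[atTop] x → ∃ z', z' =ᶠ[atTop] x ∧
      (∀ n < K, z' n = z n) ∧ (∀ n, col n < M → z' n = z n) ∧ (θ x, θ z') ∉ F M := by
    intro z K M hz
    by_contra! hcon
    -- This `y` is a limit of admissible modifications of `z`; if all of those were in `F M`, so
    -- would `y` be, although it differs from `x` infinitely often in column `M`.
    let y : ℕ → Bool := fun n => if col n = M ∧ K ≤ n then !x n else z n
    have hyC : y ∈ C := by
      refine hCinv _ (hxcol M) _ ?_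
      filter_upwards [hz, eventually_ge_atTop K] with n hn hK
      by_cases h : col n = M
      · rw [flipOn_of_mem (by exact h)]; simp [y, h, hK]
      · rw [flipOn_of_notMem (by exact h)]; simp [y, h, hn]
    have hyF : (θ x, θ y) ∈ F M := by
      by_contra hM
      obtain ⟨N, hN, hN'⟩ := mem_nhdsWithin_iff_exists_mem_nhds_inter.1 (hopen y hyC M hM)
      obtain ⟨L, hL⟩ := exists_cylinder_subset hN
      let z' : ℕ → Bool := fun n => if n < L then y n else z n
      have hz' : z' =ᶠ[atTop] x := by
        filter_upwards [hz, eventually_ge_atTop L] with n hn hL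
        simp [z', not_lt.2 hL, hn]
      refine hN' ⟨hL ?_, hCinv x hxC z' hz'⟩ (hcon z' hz' ?_ ?_)
      · intro n hn
        simp [z', hn]
      · intro n hn
        simp [z', y, not_le.2 hn]
      · intro n hn
        simp [z', y, hn.ne]
    refine ((hcol M).sdiff (Set.finite_lt_nat K)) (((hred x y).2 ⟨M, hyF⟩ M).subset ?_)
    rintro n ⟨hn, hK⟩
    have hK' : K ≤ n := not_lt.1 hK
    have hn' : col n = M := hn
    refine ⟨hn', ?_⟩
    simp [y, hn', hK']
  let σ := {s : (ℕ → Bool) × ℕ // s.1 =ᶠ[atTop] x}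
  obtain ⟨u, hu0, hu, y, hyC, hynb, hylim⟩ := exists_fusion (σ := σ) hCG (fun s => s.1.1)
    (fun s => hCinv x hxC _ s.2)
    -- The counter names the next closed set to leave, so the one just left has index one less. The
    -- implication makes the truncated subtraction at counter 0 harmless.
    (fun s => {y | (θ x, θ s.1.1) ∉ F (s.1.2 - 1) → (θ x, θ y) ∉ F (s.1.2 - 1)})
    (fun s => by
      by_cases h : (θ x, θ s.1.1) ∉ F (s.1.2 - 1)
      · filter_upwards [hopen _ (hCinv x hxC _ s.2) _ h] with y hy _ using hy
      · filter_upwards with y hy using absurd hy h)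
    (fun s s' => s'.1.2 = s.1.2 + 1 ∧ (∀ n, col n < s.1.2 → s'.1.1 n = s.1.1 n) ∧
      (θ x, θ s'.1.1) ∉ F s.1.2)
    (fun s K => by
      obtain ⟨z', h₁, h₂, h₃, h₄⟩ := claim s.1.1 K s.1.2 s.2
      exact ⟨⟨(z', s.1.2 + 1), h₁⟩, ⟨rfl, h₃, h₄⟩, h₂⟩)
    ⟨(x, 0), EventuallyEq.rfl⟩
  have hM : ∀ i, (u i).1.2 = i := by
    intro i
    induction i with
    | zero => rw [hu0]
    | succ i ih => rw [(hu i).1, ih]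
  obtain ⟨M, hMF⟩ : ∃ M, (θ x, θ y) ∈ F M := by
    refine (hred x y).1 fun k => ?_
    have hstab : ∀ i, k + 1 ≤ i → ∀ n, col n = k → (u i).1.1 n = (u (k + 1)).1.1 n := by
      intro i hi n hn
      induction i, hi using Nat.le_induction with
      | base => rfl
      | succ i hi ih => rw [(hu i).2.1 n (by rw [hM]; omega), ih]
    have hy : ∀ n, col n = k → y n = (u (k + 1)).1.1 n := by
      intro n hn
      refine tendsto_nhds_unique (tendsto_pi_nhds.1 hylim n) (tendsto_const_nhds.congr' ?_)
      filter_upwards [eventually_ge_atTop (k + 1)] with i hi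
      exact (hstab i hi n hn).symm
    refine (u (k + 1)).2.finite_ne.subset ?_
    rintro n ⟨hn, hne⟩
    have := hy n hn
    exact fun h => hne (by rw [this, h])
  have h := hynb (M + 1)
  have h' := (hu M).2.2
  simp only [hM] at h h'
  exact h h' hMF

/-! ### Weighted differences against `c₀`. -/

open scoped ENNReal

/-- The total weight of the set of coordinates at which `x` and `y` differ. -/
noncomputable def diffWeight (w : ℕ → ℝ≥0∞) (x y : ℕ → Bool) : ℝ≥0∞ :=
  ∑' n, if x n = y n then 0 else w n

lemma diffWeight_ne_top {w : ℕ → ℝ≥0∞} (hw : ∀ n, w n ≠ ∞) {x y : ℕ → Bool}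
    (h : x =ᶠ[atTop] y) : diffWeight w x y ≠ ∞ := by
  rw [diffWeight, tsum_eq_sum (s := h.finite_ne.toFinset) (fun n hn =>
    if_pos (by simpa using hn))]
  refine (ENNReal.sum_lt_top.2 fun n _ => ?_).ne
  split_ifs
  · simp
  · exact (hw n).lt_top

/-- If `z` agrees with `x` from some coordinate on, then `diffWeight w x` is at least
`diffWeight w x z` near `z`. -/
lemma eventually_diffWeight_le (w : ℕ → ℝ≥0∞) {x z : ℕ → Bool} (h : z =ᶠ[atTop] x) :
    ∀ᶠ y in 𝓝 z, diffWeight w x z ≤ diffWeight w x y := by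
  obtain ⟨K, hK⟩ := eventually_atTop.1 h
  filter_upwards [cylinder_mem_nhds z K] with y hy
  refine ENNReal.tsum_le_tsum fun n => ?_
  rcases lt_or_ge n K with hn | hn
  · rw [hy n hn]
  · simp [hK n hn]

/-- If the weights tend to zero and have infinite sum, arbitrarily far out there are blocks whose
weight is between `δ / 2` and `δ`. -/
lemma exists_block_weight {w : ℕ → ℝ≥0∞} (hw : ∀ n, w n ≠ ∞) (hw0 : Tendsto w atTop (𝓝 0))
    (hsum : ∑' n, w n = ∞) {δ : ℝ≥0∞} (hδ : δ ≠ 0) (hδ' : δ ≠ ∞) (K : ℕ) :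
    ∃ a b, K ≤ a ∧ δ / 2 ≤ ∑ n ∈ Finset.Ico a b, w n ∧ ∑ n ∈ Finset.Ico a b, w n < δ := by
  have hδ2 : 0 < δ / 2 := ENNReal.half_pos hδ
  -- Past `a` single weights are below `δ / 2`, so the first sum to reach `δ / 2` stays below `δ`.
  obtain ⟨a, ha⟩ := eventually_atTop.1
    ((hw0.eventually (gt_mem_nhds hδ2)).and (eventually_ge_atTop K))
  have hex : ∃ b, δ / 2 ≤ ∑ n ∈ Finset.Ico a b, w n := by
    by_contra! hcon
    have hle : ∑' n, w n ≤ ∑ n ∈ Finset.range a, w n + δ / 2 := by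
      refine ENNReal.tsum_le_of_sum_range_le fun b => ?_
      rcases le_total b a with hb | hb
      · exact (Finset.sum_le_sum_of_subset (Finset.range_subset_range.2 hb)).trans le_self_add
      · rw [← Finset.sum_range_add_sum_Ico _ hb]
        gcongr
        exact (hcon b).le
    rw [hsum, top_le_iff, ENNReal.add_eq_top] at hle
    rcases hle with h | h
    · exact absurd h (ENNReal.sum_lt_top.2 fun n _ => (hw n).lt_top).ne
    · exact absurd h (ENNReal.div_lt_top hδ' two_ne_zero).ne
  refine ⟨a, Nat.find hex, (ha a le_rfl).2, Nat.find_spec hex, ?_⟩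
  obtain ⟨b, hb⟩ : ∃ b, Nat.find hex = b + 1 := by
    refine Nat.exists_eq_succ_of_ne_zero fun h0 => ?_
    have := Nat.find_spec hex
    rw [h0] at this
    simp at this
    exact hδ this
  have hab : a ≤ b := by
    by_contra! hlt
    have := Nat.find_spec hex
    rw [hb, Finset.Ico_eq_empty (by omega)] at this
    simp at this
    exact hδ this
  have hmin := Nat.find_min hex (m := b) (by omega)
  rw [hb, Finset.sum_Ico_succ_top hab]
  calc _ < δ / 2 + δ / 2 := ENNReal.add_lt_add (not_le.1 hmin) (ha b hab).1
    _ = δ := ENNReal.add_halves δ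

/-- On the cylinder of length `L` around `z₀`, points of `C` at weight distance less than some `δ`
have images that are eventually, and uniformly so, `ε`-close. -/
def TailClose (w : ℕ → ℝ≥0∞) (C : Set (ℕ → Bool)) (θ : (ℕ → Bool) → ℕ → ℝ) (ε : ℝ)
    (z₀ : ℕ → Bool) (L : ℕ) : Prop :=
  ∃ δ : ℝ≥0∞, δ ≠ 0 ∧ δ ≠ ∞ ∧ ∃ m : ℕ, ∀ z ∈ C, ∀ z' ∈ C, z ∈ PiNat.cylinder z₀ L →
    z' ∈ PiNat.cylinder z₀ L → diffWeight w z z' < δ → ∀ n ≥ m, dist (θ z n) (θ z' n) ≤ ε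

lemma isOpen_setOf_tailClose (w : ℕ → ℝ≥0∞) (C : Set (ℕ → Bool)) (θ : (ℕ → Bool) → ℕ → ℝ)
    (ε : ℝ) : IsOpen {z | ∃ L, TailClose w C θ ε z L} := by
  refine isOpen_iff_mem_nhds.2 ?_
  rintro z ⟨L, hL⟩
  filter_upwards [cylinder_mem_nhds z L] with y hy
  refine ⟨L, ?_⟩
  rw [PiNat.mem_cylinder_iff_eq] at hy
  simpa only [TailClose, hy] using hL

lemma exists_le_lt_succ {K : ℕ → ℕ} (hK : StrictMono K) {n : ℕ} (h0 : K 0 ≤ n) :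
    ∃ i, K i ≤ n ∧ n < K (i + 1) := by
  have hex : ∃ i, n < K i := ⟨n + 1, (Nat.lt_succ_self n).trans_le (hK.id_le _)⟩
  obtain ⟨i, hi⟩ : ∃ i, Nat.find hex = i + 1 := by
    refine Nat.exists_eq_succ_of_ne_zero fun h => ?_
    have := Nat.find_spec hex
    rw [h] at this
    omega
  refine ⟨i, not_lt.1 (Nat.find_min hex (by omega)), ?_⟩
  rw [← hi]
  exact Nat.find_spec hex

/-- If finite weight distance forces the difference of the images to tend to zero, then cylinders
with `TailClose` are dense. -/
lemma exists_tailClose {w : ℕ → ℝ≥0∞} {C : Set (ℕ → Bool)} (hC : IsGδ C)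
    (hinv : ∀ x ∈ C, ∀ y, y =ᶠ[atTop] x → y ∈ C) {θ : (ℕ → Bool) → ℕ → ℝ}
    (hcont : ContinuousOn θ C)
    (hred : ∀ x y, diffWeight w x y ≠ ∞ →
      Tendsto (fun n => dist (θ x n) (θ y n)) atTop (𝓝 0))
    {ε : ℝ} (hε : 0 < ε) {x₀ : ℕ → Bool} (hx₀ : x₀ ∈ C) (L₀ : ℕ) :
    ∃ z ∈ PiNat.cylinder x₀ L₀, ∃ L, TailClose w C θ ε z L := by
  by_contra! hcon
  -- If closeness fails everywhere in the cylinder, fusion over pairs gives two points at finite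
  -- weight distance whose images differ by more than `ε / 2` at arbitrarily late coordinates `wit`.
  let D : Set (ℕ → Bool × Bool) :=
    {p | (fun n => (p n).1) ∈ C} ∩ {p | (fun n => (p n).2) ∈ C}
  have hfst : Continuous fun (p : ℕ → Bool × Bool) (n : ℕ) => (p n).1 := by fun_prop
  have hsnd : Continuous fun (p : ℕ → Bool × Bool) (n : ℕ) => (p n).2 := by fun_prop
  have hD : IsGδ D := (hC.preimage hfst).inter (hC.preimage hsnd)
  let σ := {s : ((ℕ → Bool) × (ℕ → Bool)) × ℕ × ℕ × ℕ //
    s.1.1 ∈ C ∧ s.1.2 ∈ C ∧ s.1.1 ∈ PiNat.cylinder x₀ L₀ ∧ L₀ ≤ s.2.1}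
  let c : σ → ℕ → Bool := fun s => s.1.1.1
  let d : σ → ℕ → Bool := fun s => s.1.1.2
  let K : σ → ℕ := fun s => s.1.2.1
  let idx : σ → ℕ := fun s => s.1.2.2.1
  let wit : σ → ℕ := fun s => s.1.2.2.2
  obtain ⟨u, hu0, hu, y, hyC, hynb, -⟩ := exists_fusion (σ := σ) hD
    (fun s n => (c s n, d s n))
    (fun s => ⟨s.2.1, s.2.2.1⟩)
    (fun s => {p | p ∈ PiNat.cylinder (fun n => (c s n, d s n)) (K s) ∧
      (ε / 2 < dist (θ (c s) (wit s)) (θ (d s) (wit s)) →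
        ε / 2 < dist (θ (fun n => (p n).1) (wit s)) (θ (fun n => (p n).2) (wit s)))})
    (fun s => by
      refine inter_mem (mem_nhdsWithin_of_mem_nhds (cylinder_mem_nhds _ _)) ?_
      by_cases h : ε / 2 < dist (θ (c s) (wit s)) (θ (d s) (wit s))
      · have h₁ : Tendsto (fun p : ℕ → Bool × Bool => θ (fun n => (p n).1))
            (𝓝[D] fun n => (c s n, d s n)) (𝓝 (θ (c s))) :=
          (hcont (c s) s.2.1).tendsto.comp (tendsto_nhdsWithin_iff.2
            ⟨(hfst.tendsto _).mono_left nhdsWithin_le_nhds,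
              eventually_mem_nhdsWithin.mono fun p hp => hp.1⟩)
        have h₂ : Tendsto (fun p : ℕ → Bool × Bool => θ (fun n => (p n).2))
            (𝓝[D] fun n => (c s n, d s n)) (𝓝 (θ (d s))) :=
          (hcont (d s) s.2.2.1).tendsto.comp (tendsto_nhdsWithin_iff.2
            ⟨(hsnd.tendsto _).mono_left nhdsWithin_le_nhds,
              eventually_mem_nhdsWithin.mono fun p hp => hp.2⟩)
        have h₃ := (tendsto_pi_nhds.1 h₁ (wit s)).dist (tendsto_pi_nhds.1 h₂ (wit s))
        filter_upwards [h₃.eventually (lt_mem_nhds h)] with p hp _ using hp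
      · filter_upwards with p hp using absurd hp h)
    (fun s s' => K s < K s' ∧ c s' ∈ PiNat.cylinder (c s) (K s') ∧
      d s' ∈ PiNat.cylinder (d s) (K s') ∧
      (∑' n, if K s' ≤ n ∧ c s' n ≠ d s' n then w n else 0) ≤ 2⁻¹ ^ idx s ∧
      idx s' = idx s + 1 ∧ idx s ≤ wit s' ∧
      ε / 2 < dist (θ (c s') (wit s')) (θ (d s') (wit s')))
    (fun s K₁ => by
      have hbad := hcon (c s) s.2.2.2.1 (max (K s + 1) K₁)
      unfold TailClose at hbad
      push Not at hbad
      obtain ⟨z, hz, z', hz', hzc, hzc', hwt, n, hn, hdist⟩ :=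
        hbad (2⁻¹ ^ idx s) (by simp) (by simp) (idx s)
      set K' := max (K s + 1) K₁ with hK'
      -- Graft the tail of `z` onto the prefix of `d s`. As the images of `z` and `z'` are over `ε`
      -- apart at `n`, one of them is over `ε / 2` from that of `e`; it becomes the new first point,
      -- at tail weight at most that of the pair `z`, `z'`.
      let e : ℕ → Bool := fun n => if n < K' then d s n else z n
      have heC : e ∈ C := by
        refine hinv z hz e ?_
        filter_upwards [eventually_ge_atTop K'] with n hn
        simp [e, not_lt.2 hn]
      have hed : e ∈ PiNat.cylinder (d s) K' := fun n hn => by simp [e, hn]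
      have hLK : L₀ ≤ K' := s.2.2.2.2.trans (by change K s ≤ K'; omega)
      have hcyl : ∀ v ∈ PiNat.cylinder (c s) K', v ∈ PiNat.cylinder x₀ L₀ := fun v hv n hn =>
        (hv n (hn.trans_le hLK)).trans (s.2.2.2.1 n hn)
      have hmain : ∀ v ∈ C, v ∈ PiNat.cylinder (c s) K' → (∀ n, v n ≠ z n → z n ≠ z' n) →
          ε / 2 < dist (θ v n) (θ e n) → ∃ s' : σ, (K s < K s' ∧
            c s' ∈ PiNat.cylinder (c s) (K s') ∧ d s' ∈ PiNat.cylinder (d s) (K s') ∧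
            (∑' n, if K s' ≤ n ∧ c s' n ≠ d s' n then w n else 0) ≤ 2⁻¹ ^ idx s ∧
            idx s' = idx s + 1 ∧ idx s ≤ wit s' ∧
            ε / 2 < dist (θ (c s') (wit s')) (θ (d s') (wit s'))) ∧
            (fun n => (c s' n, d s' n)) ∈ PiNat.cylinder (fun n => (c s n, d s n)) K₁ := by
        intro v hv hvc hvz hvd
        refine ⟨⟨((v, e), K', idx s + 1, n), hv, heC, hcyl v hvc, hLK⟩,
          ⟨by change K s < K'; omega, hvc, hed, ?_, rfl, hn, hvd⟩, fun n hn => ?_⟩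
        · refine le_trans (ENNReal.tsum_le_tsum fun n => ?_) hwt.le
          by_cases h : K' ≤ n ∧ v n ≠ e n
          · have : z n ≠ z' n := hvz n (by simpa [e, not_lt.2 h.1] using h.2)
            change (if K' ≤ n ∧ v n ≠ e n then w n else 0) ≤ _
            rw [if_pos h, if_neg this]
          · change (if K' ≤ n ∧ v n ≠ e n then w n else 0) ≤ _
            rw [if_neg h]
            exact zero_le
        · have hn' : n < K' := by omega
          exact Prod.ext (hvc n hn') (hed n hn')
      by_cases h : ε / 2 < dist (θ z n) (θ e n)
      · exact hmain z hz hzc (fun n h => absurd rfl h) h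
      · refine hmain z' hz' hzc' (fun n h => h.symm) ?_
        have := dist_triangle_right (θ z n) (θ z' n) (θ e n)
        linarith)
    ⟨((x₀, x₀), L₀, 0, 0), hx₀, hx₀, PiNat.self_mem_cylinder _ _, le_rfl⟩
  have hidx : ∀ i, idx (u i) = i := by
    intro i
    induction i with
    | zero => rw [hu0]
    | succ i ih => rw [(hu i).2.2.2.2.1, ih]
  have hKmono : StrictMono fun i => K (u i) := strictMono_nat_of_lt_succ fun i => (hu i).1
  have hyc : ∀ i, ∀ n < K (u (i + 1)), (y n).1 = c (u i) n ∧ (y n).2 = d (u i) n := by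
    intro i n hn
    have h := (hynb (i + 1)).1 n hn
    rw [h]
    exact ⟨(hu i).2.1 n hn, (hu i).2.2.1 n hn⟩
  have hfin : diffWeight w (fun n => (y n).1) (fun n => (y n).2) ≠ ∞ := by
    have hle : diffWeight w (fun n => (y n).1) (fun n => (y n).2) ≤
        ∑' i : ℕ, (2⁻¹ : ℝ≥0∞) ^ i := by
      calc diffWeight w (fun n => (y n).1) (fun n => (y n).2)
          ≤ ∑' n, ∑' i, if K (u (i + 1)) ≤ n ∧ c (u (i + 1)) n ≠ d (u (i + 1)) n
              then w n else 0 := by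
            refine ENNReal.tsum_le_tsum fun n => ?_
            split_ifs with hn
            · exact zero_le
            · replace hn : (y n).1 ≠ (y n).2 := hn
              have hc0 : c (u 0) = d (u 0) := by rw [hu0]
              have hKn : K (u 0) ≤ n := by
                by_contra! hlt
                have h := hyc 0 n (hlt.trans (hu 0).1)
                exact hn (by rw [h.1, h.2, hc0])
              obtain ⟨i, hi₁, hi₂⟩ := exists_le_lt_succ hKmono hKn
              have h := hyc i n hi₂
              rw [h.1, h.2] at hn
              cases i with
              | zero => exact absurd (congrFun hc0 n) hn
              | succ j =>
                refine le_trans ?_ (ENNReal.le_tsum j)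
                rw [if_pos ⟨hi₁, hn⟩]
        _ = ∑' i, ∑' n, if K (u (i + 1)) ≤ n ∧ c (u (i + 1)) n ≠ d (u (i + 1)) n
              then w n else 0 := ENNReal.tsum_comm
        _ ≤ ∑' i : ℕ, (2⁻¹ : ℝ≥0∞) ^ i := by
            refine ENNReal.tsum_le_tsum fun i => ?_
            have := (hu i).2.2.2.1
            rwa [hidx] at this
    refine ne_top_of_le_ne_top ?_ hle
    rw [ENNReal.tsum_geometric]
    simp
  have hlim := hred _ _ hfin
  obtain ⟨N, hN⟩ := eventually_atTop.1 (hlim.eventually (gt_mem_nhds (half_pos hε)))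
  have h₁ := (hynb (N + 1)).2 (hu N).2.2.2.2.2.2
  have h₂ : N ≤ wit (u (N + 1)) := by
    have := (hu N).2.2.2.2.2.1
    rwa [hidx] at this
  exact lt_irrefl _ (h₁.trans (hN _ h₂))

/-- Flipping finitely many blocks of small weight far out, one makes the weight distance from `x`
large while moving the image only little in the supremum norm. -/
lemma exists_diffWeight_ge_dist_lt {w : ℕ → ℝ≥0∞} (hw : ∀ n, w n ≠ ∞)
    (hw0 : Tendsto w atTop (𝓝 0)) (hsum : ∑' n, w n = ∞) {C : Set (ℕ → Bool)}
    (hinv : ∀ x ∈ C, ∀ y, y =ᶠ[atTop] x → y ∈ C) {θ : (ℕ → Bool) → ℕ → ℝ}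
    (hcont : ContinuousOn θ C)
    (hred : ∀ x y, diffWeight w x y ≠ ∞ →
      Tendsto (fun n => dist (θ x n) (θ y n)) atTop (𝓝 0))
    {η : ℝ} (hη : 0 < η) {x z : ℕ → Bool} (hx : x ∈ C) (hz : z =ᶠ[atTop] x) {L : ℕ}
    (hL : TailClose w C θ η z L) (K M : ℕ) :
    ∃ z', z' =ᶠ[atTop] x ∧ z' ∈ PiNat.cylinder z K ∧
      (∀ n, dist (θ z n) (θ z' n) < 3 * η) ∧ (M : ℝ≥0∞) ≤ diffWeight w x z' := by
  obtain ⟨δ, hδ, hδ', m, hm⟩ := hL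
  have key : ∀ j : ℕ, ∃ z', z' =ᶠ[atTop] x ∧ z' ∈ PiNat.cylinder z (max K L) ∧
      (∀ n, dist (θ z n) (θ z' n) < 3 * η) ∧ (j : ℝ≥0∞) * (δ / 2) ≤ diffWeight w x z' := by
    intro j
    induction j with
    | zero => exact ⟨z, hz, PiNat.self_mem_cylinder _ _, fun n => by simpa using hη, by simp⟩
    | succ j ih =>
      obtain ⟨v, hv, hvz, hvd, hvw⟩ := ih
      have hvC := hinv x hx v hv
      obtain ⟨N, hN⟩ := eventually_atTop.1
        ((hred z v (diffWeight_ne_top hw (hz.trans hv.symm))).eventually (gt_mem_nhds hη))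
      have hnear : ∀ᶠ y in 𝓝[C] v, ∀ n ∈ Finset.range (max m N),
          dist (θ z n) (θ y n) < 3 * η := by
        refine (Finset.eventually_all _).2 fun n _ => ?_
        exact (tendsto_const_nhds.dist (tendsto_pi_nhds.1 (hcont v hvC) n)).eventually
          (gt_mem_nhds (hvd n))
      obtain ⟨O, hO, hO'⟩ := mem_nhdsWithin_iff_exists_mem_nhds_inter.1 hnear
      obtain ⟨K₁, hK₁⟩ := exists_cylinder_subset hO
      obtain ⟨K₂, hK₂⟩ := eventually_atTop.1 hv
      obtain ⟨a, b, hKa, hab, hab'⟩ :=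
        exists_block_weight hw hw0 hsum hδ hδ' (max (max K L) (max K₁ K₂))
      let v' := flipOn (Finset.Ico a b : Set ℕ) v
      have hblock : ∀ n, n ∈ Finset.Ico a b → v' n = !v n := fun n hn =>
        flipOn_of_mem (Finset.mem_coe.2 hn) v
      have hrest : ∀ n, n ∉ Finset.Ico a b → v' n = v n := fun n hn =>
        flipOn_of_notMem (fun h => hn (Finset.mem_coe.1 h)) v
      have hlow : ∀ n < max (max K L) (max K₁ K₂), v' n = v n := fun n hn =>
        hrest n fun h => by have := (Finset.mem_Ico.1 h).1; omega
      have hv' : v' =ᶠ[atTop] x := by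
        filter_upwards [hv, eventually_ge_atTop b] with n hn hb
        rw [hrest n fun h => by have := (Finset.mem_Ico.1 h).2; omega, hn]
      have hv'C := hinv x hx v' hv'
      have hvz' : v' ∈ PiNat.cylinder z (max K L) := fun n hn => by
        rw [hlow n (by omega), hvz n hn]
      have hdw : diffWeight w v v' = ∑ n ∈ Finset.Ico a b, w n := by
        rw [diffWeight, tsum_eq_sum (s := Finset.Ico a b)
          (fun n hn => if_pos (hrest n hn).symm)]
        refine Finset.sum_congr rfl fun n hn => if_neg ?_
        rw [hblock n hn]
        cases v n <;> simp
      have hadd : diffWeight w x v' = diffWeight w x v + diffWeight w v v' := by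
        rw [diffWeight, diffWeight, diffWeight, ← ENNReal.tsum_add]
        refine tsum_congr fun n => ?_
        by_cases hn : n ∈ Finset.Ico a b
        · have hvx : v n = x n := hK₂ n (by have := (Finset.mem_Ico.1 hn).1; omega)
          rw [hblock n hn, hvx]
          simp
        · rw [hrest n hn]
          simp
      refine ⟨v', hv', hvz', fun n => ?_, ?_⟩
      -- Early coordinates keep the strict bound by continuity. Late ones cost at most `η` from `z`
      -- to `v` and `η` from `v` to `v'`, so errors do not accumulate with the number of blocks.
      · rcases lt_or_ge n (max m N) with hn | hn
        · exact hO' ⟨hK₁ fun i hi => hlow i (by omega), hv'C⟩ n (Finset.mem_range.2 hn)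
        · have h₁ : dist (θ z n) (θ v n) < η := hN n (by omega)
          have h₂ : dist (θ v n) (θ v' n) ≤ η :=
            hm v hvC v' hv'C (PiNat.cylinder_anti _ (le_max_right _ _) hvz)
              (PiNat.cylinder_anti _ (le_max_right _ _) hvz') (hdw ▸ hab') n (by omega)
          have := dist_triangle (θ z n) (θ v n) (θ v' n)
          linarith
      · rw [hadd, hdw]
        push_cast
        rw [add_mul, one_mul]
        exact add_le_add hvw hab
  obtain ⟨j, hj⟩ := ENNReal.exists_nat_mul_gt (a := δ / 2) (b := M)
    (ENNReal.half_pos hδ).ne' (ENNReal.natCast_ne_top M)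
  obtain ⟨z', h₁, h₂, h₃, h₄⟩ := key j
  exact ⟨z', h₁, PiNat.cylinder_anti _ (le_max_left _ _) h₂, h₃, hj.le.trans h₄⟩

/-- For weights that tend to zero and have infinite sum, the relation that the set of coordinates where
`x` and `y` differ has finite weight is not Borel reducible to `ℝ^ℕ / c₀`. -/
theorem not_forall_diffWeight_ne_top_iff {w : ℕ → ℝ≥0∞} (hw : ∀ n, w n ≠ ∞)
    (hw0 : Tendsto w atTop (𝓝 0)) (hsum : ∑' n, w n = ∞) {θ : (ℕ → Bool) → ℕ → ℝ}
    (hθ : @Measurable _ _ (borel _) (borel _) θ) :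
    ¬ ∀ x y, diffWeight w x y ≠ ∞ ↔ Tendsto (fun n => dist (θ x n) (θ y n)) atTop (𝓝 0) := by
  intro hred
  obtain ⟨R, hR, hcont⟩ := exists_mem_residual_continuousOn hθ
  obtain ⟨C, hCR, hCG, hCd, hCinv⟩ := exists_isGδ_tail_invariant hR
  replace hcont := hcont.mono hCR
  have hred' := fun x y => (hred x y).1
  -- Three times this is `1 / 2 / 2 ^ k`, and these steps sum to `1 / 2 ^ i` from stage `i` on.
  have hη : ∀ k : ℕ, (0 : ℝ) < 1 / 6 / 2 ^ k := fun k => by positivity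
  have hclose : ∀ k : ℕ, {z | ∃ L, TailClose w C θ (1 / 6 / 2 ^ k) z L} ∈
      residual (ℕ → Bool) := by
    intro k
    refine residual_of_dense_open (isOpen_setOf_tailClose _ _ _ _) ?_
    refine dense_iff_inter_open.2 fun U hU hne => ?_
    obtain ⟨x, hxU, hxC⟩ := hCd.inter_open_nonempty U hU hne
    obtain ⟨L₀, hL₀⟩ := exists_cylinder_subset (hU.mem_nhds hxU)
    obtain ⟨z, hz, hzL⟩ := exists_tailClose hCG hCinv hcont hred' (hη k) hxC L₀
    exact ⟨z, hL₀ hz, hzL⟩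
  obtain ⟨C', hC', hCG', hCd', hCinv'⟩ := exists_isGδ_tail_invariant
    (inter_mem (residual_of_dense_Gδ hCG hCd) (countable_iInter_mem.2 hclose))
  have hCC : C' ⊆ C := fun x hx => (hC' hx).1
  obtain ⟨x, hx⟩ := hCd'.nonempty
  let σ := {s : (ℕ → Bool) × ℕ // s.1 =ᶠ[atTop] x}
  obtain ⟨u, hu0, hu, y, hyC, hynb, hylim⟩ := exists_fusion (σ := σ) hCG' (fun s => s.1.1)
    (fun s => hCinv' x hx _ s.2)
    (fun s => {y | diffWeight w x s.1.1 ≤ diffWeight w x y})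
    (fun s => mem_nhdsWithin_of_mem_nhds (eventually_diffWeight_le w s.2))
    (fun s s' => s'.1.2 = s.1.2 + 1 ∧
      (∀ n, dist (θ s.1.1 n) (θ s'.1.1 n) ≤ 1 / 2 / 2 ^ s.1.2) ∧
      (s.1.2 : ℝ≥0∞) ≤ diffWeight w x s'.1.1)
    (fun s K => by
      obtain ⟨L, hL⟩ := Set.mem_iInter.1 (hC' (hCinv' x hx _ s.2)).2 s.1.2
      obtain ⟨z', h₁, h₂, h₃, h₄⟩ := exists_diffWeight_ge_dist_lt hw hw0 hsum hCinv hcont hred'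
        (hη s.1.2) (hCC hx) s.2 hL K s.1.2
      refine ⟨⟨(z', s.1.2 + 1), h₁⟩, ⟨rfl, fun n => (h₃ n).le.trans_eq ?_, h₄⟩, h₂⟩
      ring)
    ⟨(x, 0), EventuallyEq.rfl⟩
  have hk : ∀ i, (u i).1.2 = i := by
    intro i
    induction i with
    | zero => rw [hu0]
    | succ i ih => rw [(hu i).1, ih]
  have htop : diffWeight w x y = ∞ := by
    refine ENNReal.eq_top_of_forall_nnreal_le fun r => ?_
    obtain ⟨i, hi⟩ := exists_nat_ge r
    calc (r : ℝ≥0∞) ≤ (i : ℝ≥0∞) := by exact_mod_cast hi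
      _ ≤ diffWeight w x (u (i + 1)).1.1 := by simpa only [hk] using (hu i).2.2
      _ ≤ diffWeight w x y := hynb (i + 1)
  refine (hred x y).2 ?_ htop
  have hθlim : ∀ n, Tendsto (fun i => θ (u i).1.1 n) atTop (𝓝 (θ y n)) := fun n =>
    tendsto_pi_nhds.1 ((hcont y (hCC hyC)).tendsto.comp (tendsto_nhdsWithin_iff.2
      ⟨hylim, Eventually.of_forall fun i => hCinv x (hCC hx) _ (u i).2⟩)) n
  have hdist : ∀ i n, dist (θ (u i).1.1 n) (θ y n) ≤ 1 / 2 ^ i := fun i n =>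
    dist_le_of_le_geometric_two_of_tendsto
      (fun j => by simpa only [hk] using (hu j).2.1 n) (hθlim n) i
  refine Metric.tendsto_atTop.2 fun ε hε => ?_
  obtain ⟨i, hi⟩ := exists_pow_lt_of_lt_one (half_pos hε) (by norm_num : (1 / 2 : ℝ) < 1)
  obtain ⟨N, hN⟩ := eventually_atTop.1
    ((hred' x _ (diffWeight_ne_top hw (u i).2.symm)).eventually (gt_mem_nhds (half_pos hε)))
  refine ⟨N, fun n hn => ?_⟩
  have h₁ := hN n hn
  have h₂ := hdist i n
  have h₃ := dist_triangle (θ x n) (θ (u i).1.1 n) (θ y n)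
  rw [one_div_pow] at hi
  rw [Real.dist_0_eq_abs, abs_of_nonneg dist_nonneg]
  linarith

lemma Continuous.measurable_borel {α β : Type*} [TopologicalSpace α] [TopologicalSpace β]
    {f : α → β} (hf : Continuous f) : @Measurable α β (borel α) (borel β) f := by
  borelize α β
  exact hf.measurable

/-! ### Uniform embedding into `c₀` by bumps. -/

section Bumps

variable {M : Type*} [PseudoMetricSpace M]

/-- The minimum of `e` and of the numbers `dist x (q j) - e / 2` for `j < i`. -/
noncomputable def distMin (q : ℕ → M) (e : ℝ) (x : M) : ℕ → ℝ
  | 0 => e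
  | i + 1 => min (distMin q e x i) (dist x (q i) - e / 2)

/-- A bump supported in the ball of radius `2 * e` around `q i` that vanishes near the points `q j`
with `j < i`; for fixed `e` these form a point-finite family. -/
noncomputable def bump (q : ℕ → M) (e : ℝ) (i : ℕ) (x : M) : ℝ :=
  max 0 (min (2 * e - dist x (q i)) (distMin q e x i))

variable (q : ℕ → M) {e : ℝ}

lemma abs_distMin_sub_le (e : ℝ) (x y : M) (i : ℕ) :
    |distMin q e x i - distMin q e y i| ≤ dist x y := by
  induction i with
  | zero => simp [distMin]
  | succ i ih =>
    refine (abs_min_sub_min_le_max _ _ _ _).trans (max_le ih ?_)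
    rw [sub_sub_sub_cancel_right]
    exact abs_dist_sub_le x y (q i)

lemma abs_bump_sub_le (e : ℝ) (i : ℕ) (x y : M) : |bump q e i x - bump q e i y| ≤ dist x y := by
  refine (abs_max_sub_max_le_max _ _ _ _).trans (max_le (by simp) ?_)
  refine (abs_min_sub_min_le_max _ _ _ _).trans (max_le ?_ (abs_distMin_sub_le q e x y i))
  rw [sub_sub_sub_cancel_left, abs_sub_comm]
  exact abs_dist_sub_le x y (q i)

lemma continuous_bump (e : ℝ) (i : ℕ) : Continuous (bump q e i) :=
  LipschitzWith.continuous (K := 1) <| LipschitzWith.of_dist_le_mul fun x y => by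
    simpa [Real.dist_eq] using abs_bump_sub_le q e i x y

lemma distMin_antitone (e : ℝ) (x : M) : Antitone (distMin q e x) :=
  antitone_nat_of_succ_le fun _ => min_le_left _ _

lemma bump_nonneg (e : ℝ) (i : ℕ) (x : M) : 0 ≤ bump q e i x := le_max_left _ _

lemma bump_le (he : 0 ≤ e) (i : ℕ) (x : M) : bump q e i x ≤ e :=
  max_le he ((min_le_right _ _).trans (distMin_antitone q e x (Nat.zero_le i)))

/-- The nonpositive term of `q m` enters every later minimum; with `q` dense this gives
point-finiteness. -/
lemma bump_eq_zero_of_lt {x : M} {m i : ℕ} (hm : dist x (q m) ≤ e / 2) (hi : m < i) :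
    bump q e i x = 0 := by
  refine max_eq_left ((min_le_right _ _).trans ((distMin_antitone q e x hi).trans ?_))
  exact (min_le_right _ _).trans (by linarith)

lemma bump_eq_zero_of_le_dist {x : M} {i : ℕ} (h : 2 * e ≤ dist x (q i)) :
    bump q e i x = 0 :=
  max_eq_left ((min_le_left _ _).trans (by linarith))

lemma half_le_distMin (he : 0 ≤ e) {x : M} {i : ℕ} (h : ∀ j < i, e ≤ dist x (q j)) :
    e / 2 ≤ distMin q e x i := by
  induction i with
  | zero => exact half_le_self he
  | succ i ih =>
    exact le_min (ih fun j hj => h j (hj.trans i.lt_succ_self))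
      (by linarith [h i i.lt_succ_self])

variable {q}

/-- Take the first centre within `e` of `x`: earlier centres do not cut its bump below `e / 2` at
`x`, and `y` is outside its support. -/
lemma exists_half_le_bump (hq : DenseRange q) (he : 0 < e) {x y : M} (hxy : 4 * e ≤ dist x y) :
    ∃ i, e / 2 ≤ |bump q e i x - bump q e i y| := by
  have hex : ∃ i, dist x (q i) < e := hq.exists_dist_lt x he
  have hi := Nat.find_spec hex
  refine ⟨Nat.find hex, ?_⟩
  have hy : bump q e (Nat.find hex) y = 0 := by
    refine bump_eq_zero_of_le_dist q ?_
    have := dist_triangle_right x y (q (Nat.find hex))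
    linarith
  rw [hy, sub_zero, abs_of_nonneg (bump_nonneg q _ _ _)]
  refine le_max_of_le_right (le_min (by linarith) (half_le_distMin q he.le fun j hj => ?_))
  exact not_lt.1 (Nat.find_min hex hj)

end Bumps

/-- For a separable metric space `M` the relation `E(M, 0)` is Borel reducible to `ℝ^ℕ / c₀`. -/
theorem borelReducible_c0Equiv_real (M : Type*) [PseudoMetricSpace M]
    [TopologicalSpace.SeparableSpace M] [Nonempty M] :
    BorelReducible (c0Equiv M) (c0Equiv ℝ) := by
  obtain ⟨q, hq⟩ := TopologicalSpace.exists_dense_seq M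
  let a : ℕ ≃ ℕ × ℕ × ℕ :=
    Nat.pairEquiv.symm.trans ((Equiv.refl ℕ).prodCongr Nat.pairEquiv.symm)
  let sc : ℕ → ℝ := fun k => (1 / 2) ^ k
  have hsc : ∀ k, 0 < sc k := fun k => by positivity
  let g : ℕ × ℕ × ℕ → (ℕ → M) → ℝ := fun t x => bump q (sc t.2.1) t.2.2 (x t.1)
  refine ⟨fun x m => g (a m) x, Continuous.measurable_borel (continuous_pi fun m =>
    (continuous_bump q _ _).comp (continuous_apply _)), fun x y => ?_⟩
  have htend : (c0Equiv ℝ) (fun m => g (a m) x) (fun m => g (a m) y) ↔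
      Tendsto (fun t => |g t x - g t y|) cofinite (𝓝 0) := by
    change Tendsto ((fun t => |g t x - g t y|) ∘ a) atTop (𝓝 0) ↔ _
    rw [← Nat.cofinite_eq_atTop]
    refine ⟨fun h => ?_, fun h => h.comp a.injective.tendsto_cofinite⟩
    simpa [Function.comp_assoc] using h.comp a.symm.injective.tendsto_cofinite
  rw [htend]
  change Tendsto (fun n => dist (x n) (y n)) atTop (𝓝 0) ↔ _
  constructor
  · intro h
    refine Metric.tendsto_nhds.2 fun ε hε => ?_
    obtain ⟨N, hN⟩ := eventually_atTop.1 (h.eventually (gt_mem_nhds hε))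
    obtain ⟨K, hK⟩ := exists_pow_lt_of_lt_one hε (by norm_num : (1 / 2 : ℝ) < 1)
    have hzero : ∀ (k : ℕ) (v : M), ∃ m, ∀ i, m < i → bump q (sc k) i v = 0 := by
      intro k v
      obtain ⟨m, hm⟩ := hq.exists_dist_lt v (half_pos (hsc k))
      exact ⟨m, fun i hi => bump_eq_zero_of_lt q hm.le hi⟩
    choose I hI using hzero
    -- Large differences need an early coordinate (Lipschitz bound), a coarse scale (size bound) and
    -- a small index (point-finiteness).
    have hfin : (⋃ n ∈ Set.Iio N, ⋃ k ∈ Set.Iio K, (fun i => (n, k, i)) ''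
        Set.Iic (max (I k (x n)) (I k (y n)))).Finite :=
      (Set.finite_Iio N).biUnion fun n _ => (Set.finite_Iio K).biUnion fun k _ =>
        (Set.finite_Iic _).image _
    filter_upwards [hfin.eventually_cofinite_notMem] with t ht
    rw [Real.dist_0_eq_abs, abs_abs]
    by_contra! hge
    refine ht ?_
    obtain ⟨n, k, i⟩ := t
    simp only [Set.mem_iUnion]
    refine ⟨n, ?_, k, ?_, i, ?_, rfl⟩
    · by_contra hn
      exact absurd ((hge.trans (abs_bump_sub_le q _ _ _ _)).trans_lt (hN n (not_lt.1 hn)))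
        (lt_irrefl _)
    · by_contra hk
      have h₁ : |g (n, k, i) x - g (n, k, i) y| ≤ sc k :=
        abs_sub_le_of_nonneg_of_le (bump_nonneg q _ _ _) (bump_le q (hsc k).le _ _)
          (bump_nonneg q _ _ _) (bump_le q (hsc k).le _ _)
      have h₂ : sc k ≤ sc K :=
        pow_le_pow_of_le_one (by norm_num) (by norm_num) (not_lt.1 hk)
      exact absurd ((hge.trans (h₁.trans h₂)).trans_lt hK) (lt_irrefl _)
    · by_contra hi
      have hi' := max_lt_iff.1 (not_le.1 (mt Set.mem_Iic.2 hi))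
      have h₁ : g (n, k, i) x = 0 := hI k (x n) i hi'.1
      have h₂ : g (n, k, i) y = 0 := hI k (y n) i hi'.2
      rw [h₁, h₂, sub_zero, abs_zero] at hge
      exact absurd hε (not_lt.2 hge)
  · intro h
    refine Metric.tendsto_nhds.2 fun ε hε => ?_
    obtain ⟨k, hk⟩ := exists_pow_lt_of_lt_one (by positivity : 0 < ε / 4)
      (by norm_num : (1 / 2 : ℝ) < 1)
    have hfin : {t | ¬ |g t x - g t y| < sc k / 2}.Finite :=
      h.eventually (gt_mem_nhds (half_pos (hsc k)))
    rw [← Nat.cofinite_eq_atTop]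
    filter_upwards [(hfin.image Prod.fst).eventually_cofinite_notMem] with n hn
    rw [Real.dist_0_eq_abs, abs_of_nonneg dist_nonneg]
    by_contra! hge
    obtain ⟨i, hi⟩ := exists_half_le_bump hq (hsc k) (x := x n) (y := y n)
      (by change (1 / 2) ^ k < ε / 4 at hk; change 4 * (1 / 2) ^ k ≤ _; linarith)
    exact hn ⟨(n, k, i), not_lt.2 hi, rfl⟩

/-! ### Reductions between the relations. -/

section NormedSpace

variable (X : Type*) [NormedAddCommGroup X] [NormedSpace ℝ X]

theorem borelReducible_c0Equiv_of_nontrivial [Nontrivial X] :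
    BorelReducible (c0Equiv ℝ) (c0Equiv X) := by
  obtain ⟨e, he⟩ := exists_norm_eq X zero_le_one
  refine ⟨fun r n => r n • e, Continuous.measurable_borel (by fun_prop), fun r s => ?_⟩
  change Tendsto _ _ _ ↔ Tendsto (fun n => dist (r n • e) (s n • e)) _ _
  simp only [dist_eq_norm, ← sub_smul, norm_smul, he, mul_one]

theorem not_borelReducible_lpEquiv_c0Equiv [Nontrivial X] (p : ℝ) (hp : 1 ≤ p) :
    ¬ BorelReducible (lpEquiv X p hp) (c0Equiv ℝ) := by
  rintro ⟨θ, hθ, hred⟩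
  obtain ⟨e, he⟩ := exists_norm_eq X zero_le_one
  have hp0 : p ≠ 0 := by linarith
  -- Harmonic weights tend to zero with infinite sum; the root `p⁻¹` in `φ` makes the `p`-th powers
  -- of distances equal them.
  let v : ℕ → NNReal := fun n => 1 / (n + 1)
  let φ : (ℕ → Bool) → ℕ → X := fun x n =>
    if x n then ((v n : ℝ) ^ p⁻¹) • e else 0
  have hφ : Continuous φ := continuous_pi fun n =>
    (continuous_of_discreteTopology (f := fun b : Bool =>
      if b then ((v n : ℝ) ^ p⁻¹) • e else 0)).comp (continuous_apply n)
  have hdist : ∀ x y n, dist (φ x n) (φ y n) ^ p =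
      ((if x n = y n then 0 else v n : NNReal) : ℝ) := by
    intro x y n
    have hv : (0 : ℝ) ≤ (v n : ℝ) ^ p⁻¹ := by positivity
    have hvp : ((v n : ℝ) ^ p⁻¹) ^ p = v n := Real.rpow_inv_rpow (v n).2 hp0
    cases hx : x n <;> cases hy : y n <;>
      simp [φ, hx, hy, norm_smul, he, abs_of_nonneg hv, hvp, Real.zero_rpow hp0]
  have hiff : ∀ x y, diffWeight (fun n => (v n : ℝ≥0∞)) x y ≠ ∞ ↔
      (lpEquiv X p hp) (φ x) (φ y) := by
    intro x y
    change _ ↔ Summable fun n => dist (φ x n) (φ y n) ^ p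
    simp only [hdist]
    rw [NNReal.summable_coe, ← ENNReal.tsum_coe_ne_top_iff_summable, diffWeight]
    simp only [apply_ite ENNReal.ofNNReal, ENNReal.coe_zero]
  refine not_forall_diffWeight_ne_top_iff (w := fun n => (v n : ℝ≥0∞)) (θ := θ ∘ φ)
    (fun n => ENNReal.coe_ne_top) ?_ ?_ ?_ fun x y => (hiff x y).trans (hred _ _)
  · have h : Tendsto v atTop (𝓝 0) := by
      rw [← NNReal.tendsto_coe]
      simpa [v] using tendsto_one_div_add_atTop_nhds_zero_nat (𝕜 := ℝ)
    simpa using ENNReal.tendsto_coe.2 h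
  · by_contra h
    have h' := NNReal.summable_coe.2 (ENNReal.tsum_coe_ne_top_iff_summable.1 h)
    refine Real.not_summable_one_div_natCast ((summable_nat_add_iff 1).1 ?_)
    simpa [v] using h'
  · exact @Measurable.comp _ _ _ (borel _) (borel _) (borel _) _ _ hθ hφ.measurable_borel

end NormedSpace

theorem not_borelReducible_c0Equiv_lpEquiv (M : Type*) [PseudoMetricSpace M]
    [TopologicalSpace.SeparableSpace M] (p : ℝ) (hp : 1 ≤ p) :
    ¬ BorelReducible (c0Equiv ℝ) (lpEquiv M p hp) := by
  rintro ⟨θ, hθ, hred⟩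
  have : SecondCountableTopology M := UniformSpace.secondCountable_of_separable M
  let col : ℕ → ℕ := fun n => (Nat.unpair n).1
  have hcol : ∀ k, {n | col n = k}.Infinite := fun k =>
    Set.infinite_of_injective_forall_mem (f := fun j => Nat.pair k j)
      (fun i j h => (Nat.pair_eq_pair.1 h).2) (fun j => by simp [col])
  -- Only finitely many columns have height at least a given `ε`, so convergence to zero means
  -- finite difference in each column.
  let φ : (ℕ → Bool) → ℕ → ℝ := fun x n => if x n then (1 / 2) ^ col n else 0
  have hφ : Continuous φ := continuous_pi fun n =>
    (continuous_of_discreteTopology (f := fun b : Bool =>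
      if b then (1 / 2 : ℝ) ^ col n else 0)).comp (continuous_apply n)
  have hdist : ∀ x y n, dist (φ x n) (φ y n) = if x n = y n then 0 else (1 / 2) ^ col n := by
    intro x y n
    cases hx : x n <;> cases hy : y n <;> simp [φ, hx, hy, Real.dist_eq]
  have hφred : ∀ x y, (∀ k, {n | col n = k ∧ x n ≠ y n}.Finite) ↔
      (c0Equiv ℝ) (φ x) (φ y) := by
    intro x y
    change _ ↔ Tendsto (fun n => dist (φ x n) (φ y n)) atTop (𝓝 0)
    simp only [hdist]
    rw [← Nat.cofinite_eq_atTop]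
    constructor
    · intro h
      refine Metric.tendsto_nhds.2 fun ε hε => ?_
      obtain ⟨K, hK⟩ := exists_pow_lt_of_lt_one hε (by norm_num : (1 / 2 : ℝ) < 1)
      have hfin := (Set.finite_Iio K).biUnion fun k _ => h k
      filter_upwards [hfin.eventually_cofinite_notMem] with n hn
      split_ifs with hxy
      · simpa using hε
      · rw [Real.dist_0_eq_abs, abs_of_nonneg (by positivity)]
        refine lt_of_le_of_lt (pow_le_pow_of_le_one (by norm_num) (by norm_num) ?_) hK
        by_contra! hlt
        exact hn (Set.mem_biUnion (Set.mem_Iio.2 hlt) ⟨rfl, hxy⟩)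
    · intro h k
      have hfin : {n | ¬ (if x n = y n then 0 else (1 / 2 : ℝ) ^ col n) < (1 / 2) ^ k}.Finite :=
        h.eventually (gt_mem_nhds (by positivity))
      refine hfin.subset ?_
      rintro n ⟨rfl, hne⟩
      simp [hne]
  let F : ℕ → Set ((ℕ → M) × (ℕ → M)) := fun L =>
    {u | ∀ N, ∑ n ∈ Finset.range N, dist (u.1 n) (u.2 n) ^ p ≤ L}
  have hF : ∀ L, IsClosed (F L) := by
    intro L
    simp only [F, Set.ofPred_forall]
    refine isClosed_iInter fun N => isClosed_le ?_ continuous_const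
    refine continuous_finsetSum _ fun n _ => Continuous.rpow_const ?_ fun _ => Or.inr (by linarith)
    fun_prop
  have hFσ : ∀ u v, (lpEquiv M p hp) u v ↔ ∃ L, (u, v) ∈ F L := by
    intro u v
    have hnn : ∀ n, 0 ≤ dist (u n) (v n) ^ p := fun n => by positivity
    constructor
    · intro h
      obtain ⟨L, hL⟩ := exists_nat_ge (∑' n, dist (u n) (v n) ^ p)
      exact ⟨L, fun N => (h.sum_le_tsum _ fun n _ => hnn n).trans hL⟩
    · rintro ⟨L, hL⟩
      exact summable_of_sum_range_le hnn hL
  refine not_forall_finite_columns_iff hcol (θ := θ ∘ φ) ?_ hF fun x y =>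
    ((hφred x y).trans (hred _ _)).trans (hFσ _ _)
  exact @Measurable.comp _ _ _ (borel _) (borel _) (borel _) _ _ hθ hφ.measurable_borel

theorem mainTheorem5 (X : Type*) [NormedAddCommGroup X] [NormedSpace ℝ X] [CompleteSpace X]
    [TopologicalSpace.SeparableSpace X] [Nontrivial X] :
    BorelBireducible (c0Equiv X) (c0Equiv ℝ) ∧
      ∀ (p : ℝ) (hp : 1 ≤ p), ¬ BorelComparable (lpEquiv X p hp) (c0Equiv ℝ) := by
  refine ⟨⟨borelReducible_c0Equiv_real X, borelReducible_c0Equiv_of_nontrivial X⟩, fun p hp => ?_⟩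
  rintro (h | h)
  · exact not_borelReducible_lpEquiv_c0Equiv X p hp h
  · exact not_borelReducible_c0Equiv_lpEquiv X p hp h
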